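/- A time scale is a nonempty closed set $\mathbb T\subseteq\mathbb R$, with jump operators $\sigma(t)=\inf\{s\in\mathbb T: s>t\}$ ($\inf\emptyset=\sup\mathbb T$) and $\rho(t)=\sup\{s\in\mathbb T:s<t\}$ ($\sup\emptyset=\inf\mathbb T$), and $\mathbb T^\kappa$ is the set of $t\in\mathbb T$ that are not maximal or satisfy $\rho(t)=t$. A function $g:\mathbb T\to\mathbb R$ has $\Delta$-derivative $g^\Delta(t)$ at $t\in\mathbb T^\kappa$ if for every $\varepsilon>0$ there is $\delta>0$ such that $|g(\sigma(t))-g(s)-g^\Delta(t)(\sigma(t)-s)|\le\varepsilon|\sigma(t)-s|$ for all $s\in\mathbb T\cap(t-\delta,t+\delta)$. The $\Delta$-integral is $\int_s^r g(t)\,\Delta t=G(r)-G(s)$, where $G^\Delta=g$ on $\mathbb T^\kappa$. The exponential function $e_p(\cdot,t_0)$ of $\mathbb T$ is the solution $y$ of $y^\Delta=p(t)y$ on $\mathbb T^\kappa$, $y(t_0)=1$. Let $\mathbb T_1,\mathbb T_2$ be time scales, $a_1\in\mathbb T_1$, $a_2\in\mathbb T_2$, and let $\tilde{\mathbb T}_i=\mathbb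 T_i\cap[a_i,\infty)$ for $i=1,2$. In double integrals $s_i$ ranges over the time scale from $a_i$ to $t_i$. **(1)** Let $u,a,f:\tilde{\mathbb T}_1\times\tilde{\mathbb T}_2\to[0,\infty)$ be continuous, with $a$ nondecreasing in each variable. If $$u(t_1,t_2)\le a(t_1,t_2)+\int_{a_1}^{t_1}\int_{a_2}^{t_2}f(s_1,s_2)u(s_1,s_2)\,\Delta_2s_2\,\Delta_1s_1\qquad\text{for all }(t_1,t_2)\in\tilde{\mathbb T}_1\times\tilde{\mathbb T}_2,$$ then for all $(t_1,t_2)\in\tilde{\mathbb T}_1\times\tilde{\mathbb T}_2$ $$u(t_1,t_2)\le a(t_1,t_2)\,e_{P}(t_1,a_1),\qquad P(\tau)=\int_{a_2}^{t_2}f(\tau,s_2)\,\Delta_2s_2,$$ where $t_2$ is fixed in $P$ and $e_P$ is the exponential function of $\tilde{\mathbb T}_1$. **(2)** Let $u,a:\tilde{\mathbb T}_1\times\tilde{\mathbb T}_2\to[0,\infty)$ be continuous, with $a$ nondecreasing in each variable. Let $S=\{(t_1,t_2,s_1,s_2)\in\tilde{\mathbb T}_1\times\tilde{\mathbb T}_2\times\tilde{\mathbb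 T}_1\times\tilde{\mathbb T}_2: s_1\le t_1,\ s_2\le t_2\}$ and let $f:S\to[0,\infty)$ be continuous, and nondecreasing in $t_1$ and in $t_2$. If $$u(t_1,t_2)\le a(t_1,t_2)+\int_{a_1}^{t_1}\int_{a_2}^{t_2}f(t_1,t_2,s_1,s_2)u(s_1,s_2)\,\Delta_2s_2\,\Delta_1s_1\qquad\text{for all }(t_1,t_2)\in\tilde{\mathbb T}_1\times\tilde{\mathbb T}_2,$$ then for all $(t_1,t_2)\in\tilde{\mathbb T}_1\times\tilde{\mathbb T}_2$ $$u(t_1,t_2)\le a(t_1,t_2)\,e_{P}(t_1,a_1),\qquad P(\tau)=\int_{a_2}^{t_2}f(t_1,t_2,\tau,s_2)\,\Delta_2s_2\quad(\tau\in\mathbb T_1\cap[a_1,t_1]),$$ where $t_1,t_2$ are fixed in $P$ and $e_P$ is the exponential function of the time scale $\mathbb T_1\cap[a_1,t_1]$. (The integrals here are taken over the time scales $\mathbb T_i\cap[a_i,t_i]$, on which the integrands are defined.) **(3)** Let $u,f:\tilde{\mathbb T}_1\times\tilde{\mathbb T}_2\to[0,\infty)$ and $a:\tilde{\mathbb T}_1\times\tilde{\mathbb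 T}_2\to(0,\infty)$ be continuous, with $a$ nondecreasing in each variable, and let $p\ge q>0$ be real. If $$u(t_1,t_2)^p\le a(t_1,t_2)+\int_{a_1}^{t_1}\int_{a_2}^{t_2}f(s_1,s_2)u(s_1,s_2)^q\,\Delta_2s_2\,\Delta_1s_1\qquad\text{for all }(t_1,t_2)\in\tilde{\mathbb T}_1\times\tilde{\mathbb T}_2,$$ then for all $(t_1,t_2)\in\tilde{\mathbb T}_1\times\tilde{\mathbb T}_2$ $$u(t_1,t_2)\le a(t_1,t_2)^{1/p}\,\bigl[e_{P}(t_1,a_1)\bigr]^{1/p},\qquad P(\tau)=\int_{a_2}^{t_2}f(\tau,s_2)\,a(\tau,s_2)^{q/p-1}\,\Delta_2s_2,$$ where $t_2$ is fixed in $P$ and $e_P$ is the exponential function of $\tilde{\mathbb T}_1$. -/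

import Mathlib

namespace TimeScale

/-- A time scale: a nonempty closed subset of `ℝ`. -/
def IsTimeScale (T : Set ℝ) : Prop := T.Nonempty ∧ IsClosed T

open Classical in
/-- Forward jump operator `σ(t) = inf {s ∈ T | s > t}`, with `inf ∅ = sup T`. -/
noncomputable def sigma (T : Set ℝ) (t : ℝ) : ℝ :=
  if (T ∩ Set.Ioi t).Nonempty then sInf (T ∩ Set.Ioi t) else sSup T

open Classical in
/-- Backward jump operator `ρ(t) = sup {s ∈ T | s < t}`, with `sup ∅ = inf T`. -/
noncomputable def rho (T : Set ℝ) (t : ℝ) : ℝ :=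
  if (T ∩ Set.Iio t).Nonempty then sSup (T ∩ Set.Iio t) else sInf T

/-- `T^κ`: the points of `T` that are non-maximal or left-dense. -/
def kappa (T : Set ℝ) : Set ℝ := {t | t ∈ T ∧ ((∃ s ∈ T, t < s) ∨ rho T t = t)}

/-- `d` is a delta derivative at `t` of the function `f` on the time scale `T`
(only the values of `f` on `T` matter). -/
def HasDeltaDerivAt (T : Set ℝ) (f : ℝ → ℝ) (d t : ℝ) : Prop :=
  ∀ ε > 0, ∃ δ > 0, ∀ s ∈ T, |s - t| < δ →
    |f (sigma T t) - f s - d * (sigma T t - s)| ≤ ε * |sigma T t - s|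

/-- `F` is an antiderivative of `f` on `T`. -/
def IsAntiderivative (T : Set ℝ) (F f : ℝ → ℝ) : Prop :=
  ∀ t ∈ kappa T, HasDeltaDerivAt T F (f t) t

open Classical in
/-- The delta integral `∫_s^r f(t) Δt = F(r) - F(s)` over the time scale `T`, where `F` is an
antiderivative of `f` on `T` (with value `0` if there is none). -/
noncomputable def deltaIntegral (T : Set ℝ) (f : ℝ → ℝ) (s r : ℝ) : ℝ :=
  if h : ∃ F : ℝ → ℝ, IsAntiderivative T F f then h.choose r - h.choose s else 0

/-- `y` solves the initial value problem `y^Δ = p(t) y`, `y(t₀) = 1` on `T`. -/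
def IsExpSolution (T : Set ℝ) (p : ℝ → ℝ) (t₀ : ℝ) (y : ℝ → ℝ) : Prop :=
  (∀ t ∈ kappa T, HasDeltaDerivAt T y (p t * y t) t) ∧ y t₀ = 1

open Classical in
/-- The exponential function `e_p(t, t₀)` of the time scale `T`: the value at `t` of the solution
of `y^Δ = p(t) y`, `y(t₀) = 1` (with value `0` if there is no solution). -/
noncomputable def deltaExp (T : Set ℝ) (p : ℝ → ℝ) (t t₀ : ℝ) : ℝ :=
  if h : ∃ y : ℝ → ℝ, IsExpSolution T p t₀ y then h.choose t else 0

/-- The half-line `[a, ∞)_T`. -/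
def halfLine (T : Set ℝ) (a : ℝ) : Set ℝ := T ∩ Set.Ici a

/-- The interval `[a, b]_T`. -/
def interval (T : Set ℝ) (a b : ℝ) : Set ℝ := T ∩ Set.Icc a b

/-- Nondecreasing in each of the two variables on `A × B`. -/
def NondecreasingInEach (A B : Set ℝ) (a : ℝ → ℝ → ℝ) : Prop :=
  (∀ t₂ ∈ B, MonotoneOn (fun t₁ => a t₁ t₂) A) ∧ (∀ t₁ ∈ A, MonotoneOn (fun t₂ => a t₁ t₂) B)

/-- The domain `{(t₁, t₂, s₁, s₂) ∈ A × B × A × B | s₁ ≤ t₁, s₂ ≤ t₂}` of the kernels. -/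
def kernelDomain (A B : Set ℝ) : Set (ℝ × ℝ × ℝ × ℝ) :=
  {x | x.1 ∈ A ∧ x.2.1 ∈ B ∧ x.2.2.1 ∈ A ∧ x.2.2.2 ∈ B ∧ x.2.2.1 ≤ x.1 ∧ x.2.2.2 ≤ x.2.1}

end TimeScale

namespace TimeScale

open Set Filter Topology MeasureTheory

variable {T : Set ℝ} {a : ℝ}

/-! ### Jump operators and delta derivatives -/

/-! Everything rests on one comparison principle. If `v` is Δ-differentiable, `v^Δ ≤ P v` with `P`
nonnegative and bounded up to `b`, and `v ≤ 0` at the least point, then `v ≤ 0` up to `b`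
(`nonpos_of_deltaDeriv_le`). It is proved by a barrier argument at the first failure.

The definitions of `deltaIntegral` and `deltaExp` choose some antiderivative or solution and fall
back to `0`. Comparison with `P = 0` shows that the choice of antiderivative is irrelevant.
Existence comes from writing the Δ-integral as the Lebesgue integral of `g` composed with the floor
map onto `T` (`hasDeltaDerivAt_integral`) and from summing the Picard series
(`exists_isExpSolution`). Uniqueness of the exponential is not required, because comparison applies
to whichever solution was chosen.

For the double integral inequality, fix `(t₁, t₂)`. Monotonicity replaces `a(s₁, s₂)` by the
constant `c = a(t₁, t₂)` and the inner limit by `t₂`. The resulting majorant `w(s₁)` of `u(s₁, ·)`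
depends on `s₁` alone, starts at `c` and satisfies `w^Δ ≤ P w`, so comparing `w` with `c e_P` gives
`u ≤ c e_P` (`le_mul_deltaExp`). A kernel is frozen at `(t₁, t₂)` in the same way. The power case
becomes linear for `max (u^p / a) 1`. -/

theorem le_sigma {t : ℝ} (ht : t ∈ T) : t ≤ sigma T t := by
  unfold sigma
  split_ifs with h
  · exact le_csInf h fun s hs => hs.2.le
  · have hmax : ∀ s ∈ T, s ≤ t := fun s hs => not_lt.1 fun hlt => h ⟨s, hs, hlt⟩
    exact le_csSup ⟨t, hmax⟩ ht

theorem sigma_le {t s : ℝ} (hs : s ∈ T) (hts : t < s) : sigma T t ≤ s := by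
  unfold sigma
  rw [if_pos ⟨s, hs, hts⟩]
  exact csInf_le ⟨t, fun x hx => hx.2.le⟩ ⟨hs, hts⟩

theorem le_of_lt_sigma {t s : ℝ} (hs : s ∈ T) (hst : s < sigma T t) : s ≤ t :=
  not_lt.1 fun h => (sigma_le hs h).not_gt hst

/-- Subtracting the defining estimates at `s` and at `t` itself cancels `f (σ t)`. The tolerance is
scaled by the graininess `σ t - t`, so right-scattered points need no separate treatment. -/
theorem HasDeltaDerivAt.continuousWithinAt {f : ℝ → ℝ} {d t : ℝ} (ht : t ∈ T)
    (h : HasDeltaDerivAt T f d t) : ContinuousWithinAt f T t := by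
  rw [Metric.continuousWithinAt_iff]
  intro η hη
  set m := |sigma T t - t| with hm
  have hm0 : 0 ≤ m := abs_nonneg _
  have hε : 0 < η / (4 * (m + 1)) := by positivity
  obtain ⟨δ, hδ, H⟩ := h _ hε
  refine ⟨min δ (min 1 (η / (2 * (|d| + 1)))), by positivity, fun s hs hd => ?_⟩
  rw [Real.dist_eq] at hd ⊢
  simp only [lt_min_iff] at hd
  obtain ⟨h1, h2, h3⟩ := hd
  have e1 := H s hs h1
  have e2 := H t ht (by simpa using hδ)
  have hst : |sigma T t - s| ≤ m + 1 := by
    have : sigma T t - s = (sigma T t - t) - (s - t) := by ring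
    rw [this]
    exact (abs_sub _ _).trans (by linarith)
  have e3 : η / (4 * (m + 1)) * |sigma T t - s| ≤ η / 4 := by
    calc _ ≤ η / (4 * (m + 1)) * (m + 1) := by gcongr
      _ = η / 4 := by field_simp
  have e4 : η / (4 * (m + 1)) * |sigma T t - t| ≤ η / 4 := by
    calc _ ≤ η / (4 * (m + 1)) * (m + 1) := by gcongr; linarith
      _ = η / 4 := by field_simp
  have e5 : |d * (s - t)| < η / 2 := by
    rw [abs_mul]
    calc |d| * |s - t| ≤ (|d| + 1) * |s - t| := by gcongr; linarith
      _ < (|d| + 1) * (η / (2 * (|d| + 1))) := by gcongr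
      _ = η / 2 := by field_simp
  rw [abs_le] at e1 e2
  rw [abs_lt] at e5 ⊢
  constructor <;> linarith

theorem HasDeltaDerivAt.sub_const_mul {f g : ℝ → ℝ} {d e t : ℝ} (c : ℝ)
    (hf : HasDeltaDerivAt T f d t) (hg : HasDeltaDerivAt T g e t) :
    HasDeltaDerivAt T (fun x => f x - c * g x) (d - c * e) t := by
  intro ε hε
  obtain ⟨δ₁, h₁, H₁⟩ := hf (ε / 2) (by positivity)
  obtain ⟨δ₂, h₂, H₂⟩ := hg (ε / (2 * (|c| + 1))) (by positivity)
  refine ⟨min δ₁ δ₂, by positivity, fun s hs hd => ?_⟩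
  have e₁ := H₁ s hs (hd.trans_le (min_le_left _ _))
  have e₂ := H₂ s hs (hd.trans_le (min_le_right _ _))
  set m := |sigma T t - s|
  calc _ = |(f (sigma T t) - f s - d * (sigma T t - s))
          - c * (g (sigma T t) - g s - e * (sigma T t - s))| := by congr 1; ring
    _ ≤ ε / 2 * m + |c| * (ε / (2 * (|c| + 1)) * m) := by
        refine (abs_sub _ _).trans ?_
        rw [abs_mul]
        gcongr
    _ ≤ ε / 2 * m + (|c| + 1) * (ε / (2 * (|c| + 1)) * m) := by gcongr; linarith
    _ = ε * m := by field_simp; ring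

theorem HasDeltaDerivAt.sub_const {f : ℝ → ℝ} {d t : ℝ} (c : ℝ)
    (hf : HasDeltaDerivAt T f d t) : HasDeltaDerivAt T (fun x => f x - c) d t := by
  intro ε hε
  obtain ⟨δ, h, H⟩ := hf ε hε
  exact ⟨δ, h, fun s hs hd => by simpa using H s hs hd⟩

/-! ### Comparison -/

/-- The barrier `E` lies above each of its tangent lines, so it can be compared with `v` across a
gap as well as infinitesimally. Its rate `K + 1` exceeds `K` by one, and the slack `E c * (s - c)`
absorbs the error in the definition of the Δ-derivative, taken with tolerance `E c`. The
contradiction is found at the infimum `c` of the points where `v` exceeds `E`. -/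
theorem le_exp_of_deltaDeriv_le (hT : IsClosed T) (ha : IsLeast T a) {v d P : ℝ → ℝ} {b K : ℝ}
    (hv : ∀ t ∈ kappa T, HasDeltaDerivAt T v (d t) t)
    (hP : ∀ t ∈ T, t ≤ b → 0 ≤ P t ∧ P t ≤ K)
    (hd : ∀ t ∈ T, t ≤ b → d t ≤ P t * v t) (hva : v a ≤ 0) {ε : ℝ} (hε : 0 < ε) :
    ∀ t ∈ T, t ≤ b → v t ≤ ε * Real.exp ((K + 1) * (t - a)) := by
  set E : ℝ → ℝ := fun t => ε * Real.exp ((K + 1) * (t - a)) with hE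
  have hE0 : ∀ t, 0 < E t := fun t => by positivity
  have hEstep : ∀ t s, E t * (1 + (K + 1) * (s - t)) ≤ E s := by
    intro t s
    have h1 : E s = E t * Real.exp ((K + 1) * (s - t)) := by
      simp only [hE]
      rw [mul_assoc, ← Real.exp_add]
      ring_nf
    rw [h1]
    have := Real.add_one_le_exp ((K + 1) * (s - t))
    exact mul_le_mul_of_nonneg_left (by linarith) (hE0 t).le
  have hdE : ∀ t ∈ T, t ≤ b → v t ≤ E t → d t ≤ K * E t := by
    intro t ht htb hvt
    obtain ⟨h0, h1⟩ := hP t ht htb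
    calc d t ≤ P t * v t := hd t ht htb
      _ ≤ P t * E t := by gcongr
      _ ≤ K * E t := by have := hE0 t; gcongr
  by_contra! hcon
  obtain ⟨t₀, ht₀, ht₀b, hbad₀⟩ := hcon
  set S : Set ℝ := {t | t ∈ T ∧ t ≤ b ∧ E t < v t} with hS
  have hSne : S.Nonempty := ⟨t₀, ht₀, ht₀b, hbad₀⟩
  have hSbdd : BddBelow S := ⟨a, fun t ht => ha.2 ht.1⟩
  set c := sInf S with hc
  have hcT : c ∈ T := by
    have := csInf_mem_closure hSne hSbdd
    exact hT.closure_subset_iff.2 (fun t ht => ht.1) this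
  have hgood : ∀ t ∈ T, t < c → t ≤ b ∧ v t ≤ E t := by
    intro t ht htc
    have htb : t ≤ b := (htc.le.trans (csInf_le hSbdd ⟨ht₀, ht₀b, hbad₀⟩)).trans ht₀b
    exact ⟨htb, not_lt.1 fun h => (csInf_le hSbdd ⟨ht, htb, h⟩).not_gt htc⟩
  have hcb : c ≤ b := (csInf_le hSbdd ⟨ht₀, ht₀b, hbad₀⟩).trans ht₀b
  by_cases hcS : E c < v c
  -- Failure at `c` itself: it must be reached from the left, either by a jump from `ρ c` or as a
  -- limit of points where the bound holds.
  · have hac : a < c := by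
      refine lt_of_le_of_ne (ha.2 hcT) fun h => ?_
      rw [← h] at hcS
      linarith [hE0 a]
    have hne : (T ∩ Iio c).Nonempty := ⟨a, ha.1, hac⟩
    have hbd : BddAbove (T ∩ Iio c) := ⟨c, fun s hs => hs.2.le⟩
    have hrcl := csSup_mem_closure hne hbd
    have hr : rho T c = sSup (T ∩ Iio c) := by unfold rho; rw [if_pos hne]
    have hrT : rho T c ∈ T := by
      rw [hr]; exact hT.closure_subset_iff.2 inter_subset_left hrcl
    have hrc : rho T c ≤ c := by rw [hr]; exact csSup_le hne fun s hs => hs.2.le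
    rcases hrc.lt_or_eq with hlt | heq
    · obtain ⟨hrb, hvr⟩ := hgood _ hrT hlt
      have hsig : sigma T (rho T c) = c := by
        refine le_antisymm (sigma_le hcT hlt) ?_
        unfold sigma
        rw [if_pos ⟨c, hcT, hlt⟩]
        refine le_csInf ⟨c, hcT, hlt⟩ fun s hs => ?_
        by_contra! h
        have : s ≤ rho T c := by rw [hr]; exact le_csSup hbd ⟨hs.1, h⟩
        exact (lt_of_lt_of_le hs.2 this).false
      obtain ⟨δ, hδ, H⟩ := hv _ ⟨hrT, Or.inl ⟨c, hcT, hlt⟩⟩ _ (hE0 (rho T c))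
      -- Taking `s = ρ c` itself in the derivative estimate controls the whole jump from `ρ c` to
      -- `c`.
      have h1 := H _ hrT (by simpa using hδ)
      rw [hsig, abs_of_pos (sub_pos.2 hlt)] at h1
      have h2 := (abs_le.1 h1).2
      have h3 := mul_le_mul_of_nonneg_right (hdE _ hrT hrb hvr) (sub_pos.2 hlt).le
      have h4 := hEstep (rho T c) c
      nlinarith
    · have hcont := (hv c ⟨hcT, Or.inr heq⟩).continuousWithinAt hcT
      have hEc : Continuous E := by fun_prop
      have hcl : c ∈ closure (T ∩ Iio c) := by rw [← hr, heq] at hrcl; exact hrcl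
      exact hcS.not_ge (ContinuousWithinAt.closure_le hcl (hcont.mono inter_subset_left)
        hEc.continuousWithinAt fun y hy => (hgood y hy.1 hy.2).2)
  -- The bound holds at `c`, so failures accumulate at `c` from the right. Hence `σ c = c`, and the
  -- derivative estimate at a nearby failure is violated.
  · push Not at hcS
    have hSlt : ∀ s ∈ S, c < s := fun s hs =>
      lt_of_le_of_ne (csInf_le hSbdd hs) fun h => (h ▸ hs.2.2).not_ge hcS
    have hsig : sigma T c = c := by
      refine le_antisymm ?_ (le_sigma hcT)
      exact le_csInf hSne fun s hs => sigma_le hs.1 (hSlt s hs)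
    have hck : c ∈ kappa T := by
      obtain ⟨s, hs⟩ := hSne
      exact ⟨hcT, Or.inl ⟨s, hs.1, hSlt s hs⟩⟩
    obtain ⟨δ, hδ, H⟩ := hv _ hck _ (hE0 c)
    obtain ⟨s, hs, hsδ⟩ := exists_lt_of_csInf_lt hSne (show sInf S < c + δ by linarith)
    have hcs := hSlt s hs
    have h1 := H s hs.1 (by rw [abs_of_pos (sub_pos.2 hcs)]; linarith)
    rw [hsig, abs_of_neg (sub_neg.2 hcs)] at h1
    have h2 := (abs_le.1 h1).1
    have h3 := mul_le_mul_of_nonneg_right (hdE _ hcT hcb hcS) (sub_pos.2 hcs).le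
    have h4 := hEstep c s
    have h5 := hs.2.2
    nlinarith

theorem nonpos_of_deltaDeriv_le (hT : IsClosed T) (ha : IsLeast T a) {v d P : ℝ → ℝ} {b K : ℝ}
    (hv : ∀ t ∈ kappa T, HasDeltaDerivAt T v (d t) t)
    (hP : ∀ t ∈ T, t ≤ b → 0 ≤ P t ∧ P t ≤ K)
    (hd : ∀ t ∈ T, t ≤ b → d t ≤ P t * v t) (hva : v a ≤ 0) {t : ℝ} (ht : t ∈ T) (htb : t ≤ b) :
    v t ≤ 0 := by
  refine le_of_forall_pos_le_add fun η hη => ?_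
  have := le_exp_of_deltaDeriv_le hT ha hv hP hd hva
    (ε := η / Real.exp ((K + 1) * (t - a))) (by positivity) t ht htb
  rw [div_mul_cancel₀ _ (Real.exp_pos _).ne'] at this
  linarith

/-- Both differences `F - G` and `G - F` have zero Δ-derivative, so comparison with `P = 0` bounds
each from above. -/
theorem IsAntiderivative.sub_eq_sub (hT : IsClosed T) (ha : IsLeast T a) {F G g : ℝ → ℝ}
    (hF : IsAntiderivative T F g) (hG : IsAntiderivative T G g) {t : ℝ} (ht : t ∈ T) :
    F t - F a = G t - G a := by
  have key : ∀ F G : ℝ → ℝ, IsAntiderivative T F g → IsAntiderivative T G g →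
      F t - F a ≤ G t - G a := by
    intro F G hF hG
    have := nonpos_of_deltaDeriv_le hT ha (v := fun x => F x - 1 * G x - (F a - G a))
      (d := fun x => g x - 1 * g x) (P := fun _ => 0) (b := t) (K := 0)
      (fun x hx => ((hF x hx).sub_const_mul 1 (hG x hx)).sub_const _)
      (fun _ _ _ => ⟨le_rfl, le_rfl⟩) (fun _ _ _ => by simp) (by simp) ht le_rfl
    linarith
  exact le_antisymm (key F G hF hG) (key G F hG hF)

/-! ### The floor of a time scale and the delta integral as a Lebesgue integral -/

/-- The largest point of `T` not exceeding `x` (or `a`, to the left of `a = min T`). -/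
noncomputable def floorPt (T : Set ℝ) (a x : ℝ) : ℝ := sSup (T ∩ Iic (max a x))

theorem floorPt_set_nonempty (ha : IsLeast T a) (x : ℝ) : (T ∩ Iic (max a x)).Nonempty :=
  ⟨a, ha.1, mem_Iic.2 (le_max_left _ _)⟩

theorem floorPt_set_bddAbove (x : ℝ) : BddAbove (T ∩ Iic (max a x)) :=
  ⟨max a x, fun _ h => h.2⟩

theorem floorPt_mem_inter (hT : IsClosed T) (ha : IsLeast T a) (x : ℝ) :
    floorPt T a x ∈ T ∩ Iic (max a x) :=
  (hT.inter isClosed_Iic).csSup_mem (floorPt_set_nonempty ha x) (floorPt_set_bddAbove x)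

theorem floorPt_mem (hT : IsClosed T) (ha : IsLeast T a) (x : ℝ) : floorPt T a x ∈ T :=
  (floorPt_mem_inter hT ha x).1

theorem floorPt_le (hT : IsClosed T) (ha : IsLeast T a) {x : ℝ} (hx : a ≤ x) :
    floorPt T a x ≤ x := by
  simpa [max_eq_right hx] using (floorPt_mem_inter hT ha x).2

theorem le_floorPt {x s : ℝ} (hs : s ∈ T) (hsx : s ≤ x) : s ≤ floorPt T a x :=
  le_csSup (floorPt_set_bddAbove x) ⟨hs, hsx.trans (le_max_right _ _)⟩

theorem floorPt_mono (ha : IsLeast T a) : Monotone (floorPt T a) := fun _ y hxy =>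
  csSup_le_csSup (floorPt_set_bddAbove y) (floorPt_set_nonempty ha _)
    (inter_subset_inter_right _ (Iic_subset_Iic.2 (max_le_max le_rfl hxy)))

theorem measurable_comp_floorPt (hT : IsClosed T) (ha : IsLeast T a) {g : ℝ → ℝ}
    (hg : ContinuousOn g T) : Measurable fun x => g (floorPt T a x) :=
  (continuousOn_iff_continuous_domRestrict.1 hg).measurable.comp
    ((floorPt_mono ha).measurable.subtype_mk (h := floorPt_mem hT ha))

theorem exists_bound (hT : IsClosed T) (ha : IsLeast T a) {g : ℝ → ℝ} (hg : ContinuousOn g T)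
    (b : ℝ) : ∃ M, 0 ≤ M ∧ ∀ t ∈ T, t ≤ b → |g t| ≤ M := by
  have hK : IsCompact (T ∩ Icc a b) := isCompact_Icc.inter_left hT
  obtain ⟨M, hM⟩ := hK.exists_bound_of_continuousOn (hg.mono inter_subset_left)
  exact ⟨max M 0, le_max_right _ _, fun t ht htb =>
    (hM t ⟨ht, ha.2 ht, htb⟩).trans (le_max_left _ _)⟩

theorem intervalIntegrable_comp_floorPt (hT : IsClosed T) (ha : IsLeast T a) {g : ℝ → ℝ}
    (hg : ContinuousOn g T) (x y : ℝ) :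
    IntervalIntegrable (fun z => g (floorPt T a z)) volume x y := by
  obtain ⟨M, -, hM⟩ := exists_bound hT ha hg (max a (max x y))
  refine (intervalIntegrable_const (c := M)).mono_fun
    (measurable_comp_floorPt hT ha hg).aestronglyMeasurable ?_
  refine (ae_restrict_iff' measurableSet_uIoc).2 (ae_of_all _ fun z hz => ?_)
  refine (hM _ (floorPt_mem hT ha z) ?_).trans (le_abs_self M)
  refine (floorPt_mem_inter hT ha z).2.trans (max_le_max le_rfl ?_)
  exact hz.2

/-- On a gap `(t, σ t)` the floor is constantly `t`, so the Lebesgue integral contributes exactly `g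
t * (σ t - t)`. In general the floor of almost every point between `s` and `σ t` is within `|s - t|`
of `t`, and continuity of `g` at `t` suffices. -/
theorem hasDeltaDerivAt_integral (hT : IsClosed T) (ha : IsLeast T a) {g : ℝ → ℝ}
    (hg : ContinuousOn g T) (c : ℝ) {t : ℝ} (ht : t ∈ T) :
    HasDeltaDerivAt T (fun t => c + ∫ x in a..t, g (floorPt T a x)) (g t) t := by
  intro ε hε
  obtain ⟨δ, hδ, H⟩ := Metric.continuousWithinAt_iff.1 (hg t ht) ε hε
  refine ⟨δ, hδ, fun s hs hst => ?_⟩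
  have hint := intervalIntegrable_comp_floorPt hT ha hg
  have hσ := le_sigma ht
  have h1 : (c + ∫ x in a..sigma T t, g (floorPt T a x)) - (c + ∫ x in a..s, g (floorPt T a x))
      - g t * (sigma T t - s) = ∫ x in s..sigma T t, (g (floorPt T a x) - g t) := by
    rw [intervalIntegral.integral_sub (hint _ _) intervalIntegrable_const,
      intervalIntegral.integral_const, ← intervalIntegral.integral_interval_sub_left
        (hint a (sigma T t)) (hint a s), smul_eq_mul]
    ring
  simp only
  rw [h1, ← Real.norm_eq_abs]
  refine intervalIntegral.norm_integral_le_of_norm_le_const_ae ?_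
  -- At `x = σ t` the floor may jump away from `t`; this single point is null.
  have hne : ∀ᵐ x : ℝ, x ≠ sigma T t := by
    simp [ae_iff, measure_singleton]
  filter_upwards [hne] with x hxne hx
  have hfl : |floorPt T a x - t| ≤ |s - t| := by
    rcases le_or_gt s t with hle | hlt
    · rw [uIoc_of_le (hle.trans hσ)] at hx
      have hxσ : x < sigma T t := lt_of_le_of_ne hx.2 hxne
      have h2 : floorPt T a x ≤ t := le_of_lt_sigma (floorPt_mem hT ha x)
        ((floorPt_le hT ha ((ha.2 hs).trans hx.1.le)).trans_lt hxσ)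
      have h3 : s ≤ floorPt T a x := le_floorPt hs hx.1.le
      rw [abs_of_nonpos (by linarith), abs_of_nonpos (by linarith)]
      linarith
    · have hσs := sigma_le hs hlt
      rw [uIoc_of_ge hσs] at hx
      have h2 : t ≤ floorPt T a x := le_floorPt ht (hσ.trans hx.1.le)
      have h3 : floorPt T a x ≤ s :=
        (floorPt_le hT ha ((ha.2 ht).trans (hσ.trans hx.1.le))).trans hx.2
      rw [abs_of_nonneg (by linarith), abs_of_nonneg (by linarith)]
      linarith
  have := H (floorPt_mem hT ha x) (by rw [Real.dist_eq]; exact hfl.trans_lt hst)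
  rw [Real.dist_eq] at this
  exact this.le

theorem deltaIntegral_eq_integral (hT : IsClosed T) (ha : IsLeast T a) {g : ℝ → ℝ}
    (hg : ContinuousOn g T) {t : ℝ} (ht : t ∈ T) :
    deltaIntegral T g a t = ∫ x in a..t, g (floorPt T a x) := by
  have hG : IsAntiderivative T (fun t => 0 + ∫ x in a..t, g (floorPt T a x)) g := fun t ht =>
    hasDeltaDerivAt_integral hT ha hg 0 ht.1
  have hex : ∃ F : ℝ → ℝ, IsAntiderivative T F g := ⟨_, hG⟩
  unfold deltaIntegral
  rw [dif_pos hex, hex.choose_spec.sub_eq_sub hT ha hG ht]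
  simp

theorem continuous_integral_comp_floorPt (hT : IsClosed T) (ha : IsLeast T a) {g : ℝ → ℝ}
    (hg : ContinuousOn g T) : Continuous fun t => ∫ x in a..t, g (floorPt T a x) :=
  intervalIntegral.continuous_primitive (intervalIntegrable_comp_floorPt hT ha hg) a

theorem continuousOn_of_forall_Icc {g : ℝ → ℝ} (ha : IsLeast T a)
    (h : ∀ b, ContinuousOn g (T ∩ Icc a b)) : ContinuousOn g T := by
  intro t ht
  have h1 := h (t + 1) t ⟨ht, ha.2 ht, by linarith⟩
  refine h1.mono_of_mem_nhdsWithin ?_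
  filter_upwards [self_mem_nhdsWithin, mem_nhdsWithin_of_mem_nhds (Iio_mem_nhds (lt_add_one t))]
    with s hs hs'
  exact ⟨hs, ha.2 hs, le_of_lt hs'⟩

/-! ### The exponential function -/

/-- The terms of the Picard series of `y^Δ = p(t) y`, `y(a) = 1`. -/
noncomputable def picardTerm (T : Set ℝ) (a : ℝ) (p : ℝ → ℝ) : ℕ → ℝ → ℝ
  | 0 => fun _ => 1
  | n + 1 => fun t => ∫ x in a..t, p (floorPt T a x) * picardTerm T a p n (floorPt T a x)

theorem continuousOn_picardTerm (hT : IsClosed T) (ha : IsLeast T a) {p : ℝ → ℝ}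
    (hp : ContinuousOn p T) (n : ℕ) : ContinuousOn (picardTerm T a p n) T := by
  induction n with
  | zero => exact continuousOn_const
  | succ n ih => exact (continuous_integral_comp_floorPt hT ha (hp.mul ih)).continuousOn

/-- The floor lies at or below its argument, so the previous bound, increasing in `t`, survives the
composition and integrates as on the real line. -/
theorem abs_picardTerm_le (hT : IsClosed T) (ha : IsLeast T a) {p : ℝ → ℝ} {M b : ℝ}
    (hM0 : 0 ≤ M) (hM : ∀ t ∈ T, t ≤ b → |p t| ≤ M) (n : ℕ) :
    ∀ t ∈ T, t ≤ b → |picardTerm T a p n t| ≤ (M * (t - a)) ^ n / n.factorial := by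
  induction n with
  | zero => intro t _ _; simp [picardTerm]
  | succ n ih =>
    intro t ht htb
    have hat := ha.2 ht
    have hint : ∫ x in a..t, M * ((M * (x - a)) ^ n / n.factorial)
        = (M * (t - a)) ^ (n + 1) / (n + 1).factorial := by
      have h1 : ∀ x : ℝ, M * ((M * (x - a)) ^ n / n.factorial)
          = (M ^ (n + 1) / n.factorial) * (x - a) ^ n := fun x => by rw [mul_pow]; ring
      simp_rw [h1]
      rw [intervalIntegral.integral_const_mul,
        intervalIntegral.integral_comp_sub_right (fun x => x ^ n) a, integral_pow,
        Nat.factorial_succ, mul_pow]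
      push_cast
      simp
      field_simp
    rw [← hint, ← Real.norm_eq_abs]
    refine intervalIntegral.norm_integral_le_of_norm_le hat ?_
      (by apply Continuous.intervalIntegrable; fun_prop)
    refine ae_of_all _ fun x hx => ?_
    have hfx := floorPt_le hT ha hx.1.le
    have hfb : floorPt T a x ≤ b := hfx.trans (hx.2.trans htb)
    have hfT := floorPt_mem hT ha x
    have hfa := ha.2 hfT
    rw [norm_mul]
    refine mul_le_mul (hM _ hfT hfb) ((ih _ hfT hfb).trans ?_) (abs_nonneg _) hM0
    have : 0 ≤ M * (floorPt T a x - a) := mul_nonneg hM0 (by linarith)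
    gcongr

/-- The Picard series is dominated by an exponential series on each bounded part of `T`. Its sum is
therefore continuous on `T` and solves the integral equation, which is then Δ-differentiated. -/
theorem exists_isExpSolution (hT : IsClosed T) (ha : IsLeast T a) {p : ℝ → ℝ}
    (hp : ContinuousOn p T) : ∃ y : ℝ → ℝ, IsExpSolution T p a y := by
  set Y := picardTerm T a p with hY
  have hbound : ∀ b, ∃ M, 0 ≤ M ∧ (∀ t ∈ T, t ≤ b → |p t| ≤ M) ∧ ∀ n, ∀ t ∈ T, t ≤ b →
      |Y n t| ≤ (M * (b - a)) ^ n / n.factorial := by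
    intro b
    obtain ⟨M, hM0, hM⟩ := exists_bound hT ha hp b
    refine ⟨M, hM0, hM, fun n t ht htb => (abs_picardTerm_le hT ha hM0 hM n t ht htb).trans ?_⟩
    have := mul_nonneg hM0 (sub_nonneg.2 (ha.2 ht))
    gcongr
  have hsum : ∀ t ∈ T, Summable fun n => Y n t := by
    intro t ht
    obtain ⟨M, -, -, hM⟩ := hbound t
    exact Summable.of_norm_bounded (Real.summable_pow_div_factorial (M * (t - a)))
      fun n => hM n t ht le_rfl
  set y : ℝ → ℝ := fun t => ∑' n, Y n t with hy
  have hyc : ContinuousOn y T := by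
    refine continuousOn_of_forall_Icc ha fun b => ?_
    obtain ⟨M, -, -, hM⟩ := hbound b
    exact continuousOn_tsum
      (fun n => (continuousOn_picardTerm hT ha hp n).mono inter_subset_left)
      (Real.summable_pow_div_factorial (M * (b - a))) fun n t ht => hM n t ht.1 ht.2.2
  have hfix : ∀ t ∈ T, y t = 1 + ∫ x in a..t, p (floorPt T a x) * y (floorPt T a x) := by
    intro t ht
    obtain ⟨M, hM0, hMp, hM⟩ := hbound t
    have hs : HasSum (fun n => Y (n + 1) t)
        (∫ x in a..t, p (floorPt T a x) * y (floorPt T a x)) := by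
      have hsb := (Real.summable_pow_div_factorial (M * (t - a))).mul_left M
      refine intervalIntegral.hasSum_integral_of_dominated_convergence
        (fun n _ => M * ((M * (t - a)) ^ n / n.factorial))
        (fun n => (measurable_comp_floorPt hT ha
          (hp.mul (continuousOn_picardTerm hT ha hp n))).aestronglyMeasurable)
        (fun n => ae_of_all _ fun x hx => ?_) (ae_of_all _ fun _ _ => hsb)
        intervalIntegrable_const (ae_of_all _ fun x _ => ?_)
      · rw [uIoc_of_le (ha.2 ht)] at hx
        have hfT := floorPt_mem hT ha x
        have hft := (floorPt_le hT ha hx.1.le).trans hx.2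
        rw [norm_mul]
        exact mul_le_mul (hMp _ hfT hft) (hM n _ hfT hft) (abs_nonneg _) hM0
      · exact (hsum _ (floorPt_mem hT ha x)).hasSum.mul_left _
    rw [← hs.tsum_eq]
    exact (hsum t ht).tsum_eq_zero_add
  -- The integral equation is available only on `T`, while the Δ-derivative also evaluates `y` at `σ
  -- t`.
  have hsigma : ∀ t ∈ T, sigma T t ∈ T := by
    intro t ht
    unfold sigma
    split_ifs with h
    · exact hT.closure_subset_iff.2 inter_subset_left
        (csInf_mem_closure h ⟨t, fun s hs => hs.2.le⟩)
    · have hmax : ∀ s ∈ T, s ≤ t := fun s hs => not_lt.1 fun hlt => h ⟨s, hs, hlt⟩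
      exact hT.csSup_mem ⟨t, ht⟩ ⟨t, hmax⟩
  refine ⟨y, fun t ht ε hε => ?_, ?_⟩
  · obtain ⟨δ, hδ, H⟩ := hasDeltaDerivAt_integral hT ha (hp.mul hyc) 1 ht.1 ε hε
    refine ⟨δ, hδ, fun s hs hst => ?_⟩
    have := H s hs hst
    simp only [Pi.mul_apply] at this
    rwa [← hfix s hs, ← hfix _ (hsigma t ht.1)] at this
  · rw [hfix a ha.1]; simp

/-! ### Monotonicity of integrals and iterated integrals -/

theorem isExpSolution_deltaExp (hT : IsClosed T) (ha : IsLeast T a) {p : ℝ → ℝ}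
    (hp : ContinuousOn p T) : ∃ y : ℝ → ℝ, IsExpSolution T p a y ∧ ∀ t, deltaExp T p t a = y t := by
  have hex := exists_isExpSolution hT ha hp
  refine ⟨hex.choose, hex.choose_spec, fun t => ?_⟩
  unfold deltaExp
  rw [dif_pos hex]

theorem integral_comp_floorPt_mono (hT : IsClosed T) (ha : IsLeast T a) {g h : ℝ → ℝ}
    (hg : ContinuousOn g T) (hh : ContinuousOn h T) {s t : ℝ} (has : a ≤ s) (hst : s ≤ t)
    (hgh : ∀ x ∈ T, x ≤ s → g x ≤ h x) (hh0 : ∀ x ∈ T, x ≤ t → 0 ≤ h x) :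
    ∫ x in a..s, g (floorPt T a x) ≤ ∫ x in a..t, h (floorPt T a x) := by
  have hi := intervalIntegrable_comp_floorPt hT ha hh
  have h1 : ∫ x in a..s, g (floorPt T a x) ≤ ∫ x in a..s, h (floorPt T a x) :=
    intervalIntegral.integral_mono_on has (intervalIntegrable_comp_floorPt hT ha hg _ _)
      (hi _ _) fun x hx =>
        hgh _ (floorPt_mem hT ha x) ((floorPt_le hT ha hx.1).trans hx.2)
  have h2 : 0 ≤ ∫ x in s..t, h (floorPt T a x) :=
    intervalIntegral.integral_nonneg hst fun x hx =>
      hh0 _ (floorPt_mem hT ha x) ((floorPt_le hT ha (has.trans hx.1)).trans hx.2)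
  rw [← intervalIntegral.integral_add_adjacent_intervals (hi a s) (hi s t)]
  linarith

theorem deltaIntegral_mono (hT : IsClosed T) (ha : IsLeast T a) {g h : ℝ → ℝ}
    (hg : ContinuousOn g T) (hh : ContinuousOn h T) {s t : ℝ} (hs : s ∈ T) (ht : t ∈ T)
    (hst : s ≤ t) (hgh : ∀ x ∈ T, x ≤ s → g x ≤ h x) (hh0 : ∀ x ∈ T, x ≤ t → 0 ≤ h x) :
    deltaIntegral T g a s ≤ deltaIntegral T h a t := by
  rw [deltaIntegral_eq_integral hT ha hg hs, deltaIntegral_eq_integral hT ha hh ht]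
  exact integral_comp_floorPt_mono hT ha hg hh (ha.2 hs) hst hgh hh0

theorem deltaIntegral_nonneg (hT : IsClosed T) (ha : IsLeast T a) {g : ℝ → ℝ}
    (hg : ContinuousOn g T) {t : ℝ} (ht : t ∈ T) (hg0 : ∀ x ∈ T, x ≤ t → 0 ≤ g x) :
    0 ≤ deltaIntegral T g a t := by
  rw [deltaIntegral_eq_integral hT ha hg ht]
  exact intervalIntegral.integral_nonneg (ha.2 ht) fun x hx =>
    hg0 _ (floorPt_mem hT ha x) ((floorPt_le hT ha hx.1).trans hx.2)

theorem deltaIntegral_mul_const (hT : IsClosed T) (ha : IsLeast T a) {g : ℝ → ℝ}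
    (hg : ContinuousOn g T) {t : ℝ} (ht : t ∈ T) (c : ℝ) :
    deltaIntegral T (fun x => g x * c) a t = deltaIntegral T g a t * c := by
  rw [deltaIntegral_eq_integral hT ha (hg.fun_mul continuousOn_const) ht,
    deltaIntegral_eq_integral hT ha hg ht, ← intervalIntegral.integral_mul_const]

theorem isClosed_interval (hT : IsClosed T) (a b : ℝ) : IsClosed (interval T a b) :=
  hT.inter isClosed_Icc

theorem isLeast_interval (ha : a ∈ T) {b : ℝ} (hab : a ≤ b) : IsLeast (interval T a b) a :=
  ⟨⟨ha, le_rfl, hab⟩, fun _ h => h.2.1⟩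

theorem isClosed_halfLine (hT : IsClosed T) (a : ℝ) : IsClosed (halfLine T a) :=
  hT.inter isClosed_Ici

theorem isLeast_halfLine (ha : a ∈ T) : IsLeast (halfLine T a) a :=
  ⟨⟨ha, mem_Ici.2 le_rfl⟩, fun _ h => h.2⟩

theorem floorPt_interval {b s x : ℝ} (hx : x ∈ Icc a s) (hsb : s ≤ b) :
    floorPt (interval T a b) a x = floorPt (interval T a s) a x := by
  unfold floorPt interval
  rw [max_eq_right hx.1]
  congr 1
  ext y
  simp only [mem_inter_iff, mem_Icc, mem_Iic]
  have := hx.2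
  constructor
  · rintro ⟨⟨h1, h2, h3⟩, h4⟩
    exact ⟨⟨h1, h2, by linarith⟩, h4⟩
  · rintro ⟨⟨h1, h2, h3⟩, h4⟩
    exact ⟨⟨h1, h2, by linarith⟩, h4⟩

/-- Below `s` the floor maps of the two truncations agree. This lets integrals over intervals with
varying endpoints be compared on one fixed interval. -/
theorem deltaIntegral_interval (hT : IsClosed T) (ha : a ∈ T) {g : ℝ → ℝ} {b s : ℝ}
    (hg : ContinuousOn g (interval T a b)) (hs : s ∈ interval T a b) :
    deltaIntegral (interval T a s) g a s = deltaIntegral (interval T a b) g a s := by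
  have has : a ≤ s := hs.2.1
  have hsb : s ≤ b := hs.2.2
  rw [deltaIntegral_eq_integral (isClosed_interval hT a b)
      (isLeast_interval ha (has.trans hsb)) hg hs,
    deltaIntegral_eq_integral (isClosed_interval hT a s) (isLeast_interval ha has)
      (hg.mono fun x hx => ⟨hx.1, hx.2.1, hx.2.2.trans hsb⟩) ⟨hs.1, has, le_rfl⟩]
  refine intervalIntegral.integral_congr fun x hx => ?_
  rw [uIcc_of_le has] at hx
  simp only [floorPt_interval (T := T) hx hsb]

variable {A B : Set ℝ} {a₁ a₂ : ℝ}

theorem continuousOn_section {k : ℝ → ℝ → ℝ}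
    (hk : ContinuousOn (fun x : ℝ × ℝ => k x.1 x.2) (A ×ˢ B)) {s : ℝ} (hs : s ∈ A) :
    ContinuousOn (k s) B :=
  hk.comp (f := fun y => (s, y)) (by fun_prop) fun _ hy => ⟨hs, hy⟩

/-- Dominated convergence, with a constant bound on each compact rectangle. -/
theorem continuousOn_deltaIntegral (hA : IsClosed A) (hB : IsClosed B) (ha₁ : IsLeast A a₁)
    (ha₂ : IsLeast B a₂) {k : ℝ → ℝ → ℝ}
    (hk : ContinuousOn (fun x : ℝ × ℝ => k x.1 x.2) (A ×ˢ B)) {t : ℝ} (ht : t ∈ B) :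
    ContinuousOn (fun s => deltaIntegral B (fun y => k s y) a₂ t) A := by
  refine ContinuousOn.congr (f := fun s => ∫ y in a₂..t, k s (floorPt B a₂ y)) ?_
    fun s hs => deltaIntegral_eq_integral hB ha₂ (continuousOn_section hk hs) ht
  refine continuousOn_of_forall_Icc ha₁ fun b => ?_
  have hK : IsCompact ((A ∩ Icc a₁ b) ×ˢ (B ∩ Icc a₂ t)) :=
    (isCompact_Icc.inter_left hA).prod (isCompact_Icc.inter_left hB)
  obtain ⟨M, hM⟩ := hK.exists_bound_of_continuousOn
    (hk.mono (prod_mono inter_subset_left inter_subset_left))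
  intro s hs
  refine intervalIntegral.continuousWithinAt_of_dominated_interval (bound := fun _ => M)
    ?_ ?_ intervalIntegrable_const ?_
  · filter_upwards [self_mem_nhdsWithin] with s' hs'
    exact (measurable_comp_floorPt hB ha₂ (continuousOn_section hk hs'.1)).aestronglyMeasurable
  · filter_upwards [self_mem_nhdsWithin] with s' hs'
    refine ae_of_all _ fun y hy => ?_
    rw [uIoc_of_le (ha₂.2 ht)] at hy
    have hf := floorPt_mem hB ha₂ y
    exact hM (s', floorPt B a₂ y) ⟨hs', hf, ha₂.2 hf, (floorPt_le hB ha₂ hy.1.le).trans hy.2⟩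
  · refine ae_of_all _ fun y _ => ?_
    have hf := floorPt_mem hB ha₂ y
    exact (hk.comp (f := fun z => (z, floorPt B a₂ y)) (t := A ×ˢ B) (by fun_prop)
      fun z hz => ⟨hz, hf⟩).mono inter_subset_left s hs

/-! ### The linear inequality with a constant majorant -/

/-- With the inner limit fixed at `t₂`, the right-hand side `w` does not depend on `s₂`, so it
factors out of the inner integral and gives `w^Δ = H ≤ P w`. Then `w - c y` vanishes at `a₁` and
satisfies the comparison inequality for any solution `y`; no sign of `c` is needed. -/
theorem le_mul_deltaExp (hA : IsClosed A) (hB : IsClosed B) (ha₁ : IsLeast A a₁)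
    (ha₂ : IsLeast B a₂) {u f : ℝ → ℝ → ℝ} {c t₁ t₂ : ℝ}
    (hu : ContinuousOn (fun x : ℝ × ℝ => u x.1 x.2) (A ×ˢ B))
    (hf : ContinuousOn (fun x : ℝ × ℝ => f x.1 x.2) (A ×ˢ B))
    (hf0 : ∀ s₁ ∈ A, ∀ s₂ ∈ B, 0 ≤ f s₁ s₂) (ht₁ : t₁ ∈ A) (ht₂ : t₂ ∈ B)
    (h : ∀ s₁ ∈ A, s₁ ≤ t₁ → ∀ s₂ ∈ B, s₂ ≤ t₂ →
      u s₁ s₂ ≤ c + deltaIntegral A (fun x =>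
        deltaIntegral B (fun y => f x y * u x y) a₂ t₂) a₁ s₁) :
    u t₁ t₂ ≤ c * deltaExp A (fun τ => deltaIntegral B (fun y => f τ y) a₂ t₂) t₁ a₁ := by
  set P : ℝ → ℝ := fun τ => deltaIntegral B (fun y => f τ y) a₂ t₂ with hP
  set H : ℝ → ℝ := fun τ => deltaIntegral B (fun y => f τ y * u τ y) a₂ t₂ with hH
  have hfu : ContinuousOn (fun x : ℝ × ℝ => f x.1 x.2 * u x.1 x.2) (A ×ˢ B) := hf.mul hu
  have hPc : ContinuousOn P A := continuousOn_deltaIntegral hA hB ha₁ ha₂ hf ht₂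
  have hHc : ContinuousOn H A :=
    continuousOn_deltaIntegral (k := fun x y => f x y * u x y) hA hB ha₁ ha₂ hfu ht₂
  set w : ℝ → ℝ := fun t => c + ∫ x in a₁..t, H (floorPt A a₁ x) with hw
  have huw : ∀ s₁ ∈ A, s₁ ≤ t₁ → ∀ s₂ ∈ B, s₂ ≤ t₂ → u s₁ s₂ ≤ w s₁ := by
    intro s₁ hs₁ hst₁ s₂ hs₂ hst₂
    have := h s₁ hs₁ hst₁ s₂ hs₂ hst₂
    rwa [deltaIntegral_eq_integral hA ha₁ hHc hs₁] at this
  obtain ⟨y, ⟨hy, hy1⟩, hexp⟩ := isExpSolution_deltaExp hA ha₁ hPc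
  rw [hexp]
  obtain ⟨K, -, hK⟩ := exists_bound hA ha₁ hPc t₁
  have hle := nonpos_of_deltaDeriv_le hA ha₁ (v := fun t => w t - c * y t)
    (d := fun t => H t - c * (P t * y t)) (P := P) (b := t₁) (K := K)
    (fun t ht => (hasDeltaDerivAt_integral hA ha₁ hHc c ht.1).sub_const_mul c (hy t ht))
    (fun t ht htb => ⟨deltaIntegral_nonneg hB ha₂ (continuousOn_section hf ht) ht₂
      fun x hx _ => hf0 t ht x hx, (le_abs_self _).trans (hK t ht htb)⟩)
    (fun t ht htb => ?_) (by simp [hw, hy1]) ht₁ le_rfl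
  · have := huw t₁ ht₁ le_rfl t₂ ht₂ le_rfl
    linarith
  · have : H t ≤ P t * w t := by
      have hft := continuousOn_section hf ht
      change deltaIntegral B (fun y => f t y * u t y) a₂ t₂
        ≤ deltaIntegral B (fun y => f t y) a₂ t₂ * w t
      rw [← deltaIntegral_mul_const hB ha₂ hft ht₂,
        deltaIntegral_eq_integral hB ha₂ (continuousOn_section
          (k := fun x y => f x y * u x y) hfu ht) ht₂,
        deltaIntegral_eq_integral hB ha₂ (hft.fun_mul continuousOn_const) ht₂]
      refine intervalIntegral.integral_mono_on (ha₂.2 ht₂)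
        (intervalIntegrable_comp_floorPt hB ha₂ (continuousOn_section
          (k := fun x y => f x y * u x y) hfu ht) _ _)
        (intervalIntegrable_comp_floorPt hB ha₂ (hft.fun_mul continuousOn_const) _ _) fun x hx => ?_
      have hx' := floorPt_mem hB ha₂ x
      exact mul_le_mul_of_nonneg_left
        (huw t ht htb _ hx' ((floorPt_le hB ha₂ hx.1).trans hx.2)) (hf0 t ht _ hx')
    linarith

theorem le_mul_deltaExp_of_le_add (hA : IsClosed A) (hB : IsClosed B) (ha₁ : IsLeast A a₁)
    (ha₂ : IsLeast B a₂) {u a f : ℝ → ℝ → ℝ}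
    (hu : ContinuousOn (fun x : ℝ × ℝ => u x.1 x.2) (A ×ˢ B))
    (hf : ContinuousOn (fun x : ℝ × ℝ => f x.1 x.2) (A ×ˢ B))
    (hu0 : ∀ t₁ ∈ A, ∀ t₂ ∈ B, 0 ≤ u t₁ t₂) (hf0 : ∀ t₁ ∈ A, ∀ t₂ ∈ B, 0 ≤ f t₁ t₂)
    (hmono : NondecreasingInEach A B a)
    (h : ∀ t₁ ∈ A, ∀ t₂ ∈ B, u t₁ t₂ ≤ a t₁ t₂ + deltaIntegral A (fun s₁ =>
      deltaIntegral B (fun s₂ => f s₁ s₂ * u s₁ s₂) a₂ t₂) a₁ t₁)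
    {t₁ t₂ : ℝ} (ht₁ : t₁ ∈ A) (ht₂ : t₂ ∈ B) :
    u t₁ t₂ ≤ a t₁ t₂ *
      deltaExp A (fun τ => deltaIntegral B (fun s₂ => f τ s₂) a₂ t₂) t₁ a₁ := by
  refine le_mul_deltaExp hA hB ha₁ ha₂ hu hf hf0 ht₁ ht₂ fun s₁ hs₁ hst₁ s₂ hs₂ hst₂ => ?_
  have hfu : ContinuousOn (fun x : ℝ × ℝ => f x.1 x.2 * u x.1 x.2) (A ×ˢ B) := hf.mul hu
  have hfu0 : ∀ x ∈ A, ∀ y ∈ B, 0 ≤ f x y * u x y := fun x hx y hy =>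
    mul_nonneg (hf0 x hx y hy) (hu0 x hx y hy)
  have hc := fun t ht => continuousOn_deltaIntegral (k := fun x y => f x y * u x y)
    hA hB ha₁ ha₂ hfu (t := t) ht
  have hs := fun x hx => continuousOn_section (k := fun x y => f x y * u x y) hfu (s := x) hx
  refine (h s₁ hs₁ s₂ hs₂).trans (add_le_add ?_ ?_)
  · exact (hmono.1 s₂ hs₂ hs₁ ht₁ hst₁).trans (hmono.2 t₁ ht₁ hs₂ ht₂ hst₂)
  · refine deltaIntegral_mono hA ha₁ (hc s₂ hs₂) (hc t₂ ht₂) hs₁ hs₁ le_rfl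
      (fun x hx _ => ?_) fun x hx _ => ?_
    · exact deltaIntegral_mono hB ha₂ (hs x hx) (hs x hx) hs₂ ht₂ hst₂ (fun _ _ _ => le_rfl)
        fun y hy _ => hfu0 x hx y hy
    · exact deltaIntegral_nonneg hB ha₂ (hs x hx) ht₂ fun y hy _ => hfu0 x hx y hy

/-! ### The linear inequality with a kernel -/

/-- For `s₁ ≤ t₁` and `s₂ ≤ t₂`, monotonicity allows the kernel to be frozen at `(t₁, t₂)`, after
which it depends only on the integration variables. The work lies in passing between the intervals
ending at `sᵢ` and at `tᵢ`. -/
theorem le_mul_deltaExp_of_le_add_kernel {T₁ T₂ : Set ℝ} (hT₁ : IsClosed T₁) (hT₂ : IsClosed T₂)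
    (ha₁ : a₁ ∈ T₁) (ha₂ : a₂ ∈ T₂) {u a : ℝ → ℝ → ℝ} {f : ℝ → ℝ → ℝ → ℝ → ℝ}
    (hA : A = halfLine T₁ a₁) (hB : B = halfLine T₂ a₂)
    (hu : ContinuousOn (fun x : ℝ × ℝ => u x.1 x.2) (A ×ˢ B))
    (hf : ContinuousOn (fun x : ℝ × ℝ × ℝ × ℝ => f x.1 x.2.1 x.2.2.1 x.2.2.2)
      (kernelDomain A B))
    (hu0 : ∀ t₁ ∈ A, ∀ t₂ ∈ B, 0 ≤ u t₁ t₂)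
    (hf0 : ∀ x ∈ kernelDomain A B, 0 ≤ f x.1 x.2.1 x.2.2.1 x.2.2.2)
    (hmono : NondecreasingInEach A B a)
    (hfmono : ∀ s₁ ∈ A, ∀ s₂ ∈ B, NondecreasingInEach (A ∩ Ici s₁) (B ∩ Ici s₂)
      fun t₁ t₂ => f t₁ t₂ s₁ s₂)
    (h : ∀ t₁ ∈ A, ∀ t₂ ∈ B, u t₁ t₂ ≤ a t₁ t₂ +
      deltaIntegral (interval T₁ a₁ t₁) (fun s₁ => deltaIntegral (interval T₂ a₂ t₂)
        (fun s₂ => f t₁ t₂ s₁ s₂ * u s₁ s₂) a₂ t₂) a₁ t₁)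
    {t₁ t₂ : ℝ} (ht₁ : t₁ ∈ A) (ht₂ : t₂ ∈ B) :
    u t₁ t₂ ≤ a t₁ t₂ * deltaExp (interval T₁ a₁ t₁)
      (fun τ => deltaIntegral (interval T₂ a₂ t₂) (fun s₂ => f t₁ t₂ τ s₂) a₂ t₂) t₁ a₁ := by
  have hA' : ∀ {x}, x ∈ A ↔ x ∈ T₁ ∧ a₁ ≤ x := by rw [hA]; exact Iff.rfl
  have hB' : ∀ {x}, x ∈ B ↔ x ∈ T₂ ∧ a₂ ≤ x := by rw [hB]; exact Iff.rfl
  have hIA : ∀ t, interval T₁ a₁ t ⊆ A := fun t x hx => hA'.2 ⟨hx.1, hx.2.1⟩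
  have hIB : ∀ t, interval T₂ a₂ t ⊆ B := fun t x hx => hB'.2 ⟨hx.1, hx.2.1⟩
  have hcI := isClosed_interval hT₁ a₁
  have hcJ := isClosed_interval hT₂ a₂
  have hlI : ∀ t ∈ A, IsLeast (interval T₁ a₁ t) a₁ := fun t ht =>
    isLeast_interval ha₁ (hA'.1 ht).2
  have hlJ : ∀ t ∈ B, IsLeast (interval T₂ a₂ t) a₂ := fun t ht =>
    isLeast_interval ha₂ (hB'.1 ht).2
  have hmI : ∀ t ∈ A, t ∈ interval T₁ a₁ t := fun t ht => ⟨(hA'.1 ht).1, (hA'.1 ht).2, le_rfl⟩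
  have hmJ : ∀ t ∈ B, t ∈ interval T₂ a₂ t := fun t ht => ⟨(hB'.1 ht).1, (hB'.1 ht).2, le_rfl⟩
  have hker : ∀ s₁ ∈ A, ∀ s₂ ∈ B, ∀ x ∈ interval T₁ a₁ s₁, ∀ y ∈ interval T₂ a₂ s₂,
      (s₁, s₂, x, y) ∈ kernelDomain A B := fun s₁ hs₁ s₂ hs₂ x hx y hy =>
    ⟨hs₁, hs₂, hIA _ hx, hIB _ hy, hx.2.2, hy.2.2⟩
  have hfc : ∀ s₁ ∈ A, ∀ s₂ ∈ B, ContinuousOn (fun x : ℝ × ℝ => f s₁ s₂ x.1 x.2)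
      (interval T₁ a₁ s₁ ×ˢ interval T₂ a₂ s₂) := fun s₁ hs₁ s₂ hs₂ =>
    hf.comp (f := fun x : ℝ × ℝ => (s₁, s₂, x.1, x.2)) (by fun_prop)
      fun x hx => hker s₁ hs₁ s₂ hs₂ _ hx.1 _ hx.2
  have huc : ∀ s₁ s₂, ContinuousOn (fun x : ℝ × ℝ => u x.1 x.2)
      (interval T₁ a₁ s₁ ×ˢ interval T₂ a₂ s₂) := fun s₁ s₂ =>
    hu.mono (prod_mono (hIA _) (hIB _))
  have hfuc : ∀ s₁ ∈ A, ∀ s₂ ∈ B, ContinuousOn (fun x : ℝ × ℝ => f s₁ s₂ x.1 x.2 * u x.1 x.2)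
      (interval T₁ a₁ s₁ ×ˢ interval T₂ a₂ s₂) := fun s₁ hs₁ s₂ hs₂ =>
    (hfc s₁ hs₁ s₂ hs₂).mul (huc s₁ s₂)
  have hfu0 : ∀ s₁ ∈ A, ∀ s₂ ∈ B, ∀ x ∈ interval T₁ a₁ s₁, ∀ y ∈ interval T₂ a₂ s₂,
      0 ≤ f s₁ s₂ x y * u x y := fun s₁ hs₁ s₂ hs₂ x hx y hy =>
    mul_nonneg (hf0 _ (hker s₁ hs₁ s₂ hs₂ x hx y hy)) (hu0 _ (hIA _ hx) _ (hIB _ hy))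
  refine le_mul_deltaExp (hcI t₁) (hcJ t₂) (hlI t₁ ht₁) (hlJ t₂ ht₂) (huc t₁ t₂)
    (hfc t₁ ht₁ t₂ ht₂) (fun x hx y hy => hf0 _ (hker t₁ ht₁ t₂ ht₂ x hx y hy))
    (hmI t₁ ht₁) (hmJ t₂ ht₂) fun s₁ hs₁ hst₁ s₂ hs₂ hst₂ => ?_
  have hs₁A := hIA _ hs₁
  have hs₂B := hIB _ hs₂
  have hsubI : interval T₁ a₁ s₁ ⊆ interval T₁ a₁ t₁ := fun x hx =>
    ⟨hx.1, hx.2.1, hx.2.2.trans hst₁⟩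
  have hsubJ : interval T₂ a₂ s₂ ⊆ interval T₂ a₂ t₂ := fun x hx =>
    ⟨hx.1, hx.2.1, hx.2.2.trans hst₂⟩
  have houter : ContinuousOn (fun x => deltaIntegral (interval T₂ a₂ t₂)
      (fun y => f t₁ t₂ x y * u x y) a₂ t₂) (interval T₁ a₁ t₁) :=
    continuousOn_deltaIntegral (k := fun x y => f t₁ t₂ x y * u x y) (hcI t₁) (hcJ t₂)
      (hlI t₁ ht₁) (hlJ t₂ ht₂) (hfuc t₁ ht₁ t₂ ht₂) (hmJ t₂ ht₂)
  have hinner : ContinuousOn (fun x => deltaIntegral (interval T₂ a₂ s₂)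
      (fun y => f s₁ s₂ x y * u x y) a₂ s₂) (interval T₁ a₁ s₁) :=
    continuousOn_deltaIntegral (k := fun x y => f s₁ s₂ x y * u x y) (hcI s₁) (hcJ s₂)
      (hlI s₁ hs₁A) (hlJ s₂ hs₂B) (hfuc s₁ hs₁A s₂ hs₂B) (hmJ s₂ hs₂B)
  refine (h s₁ hs₁A s₂ hs₂B).trans (add_le_add ?_ ?_)
  · exact (hmono.1 s₂ hs₂B hs₁A ht₁ hst₁).trans (hmono.2 t₁ ht₁ hs₂B ht₂ hst₂)
  -- The kernel at `(s₁, s₂)` is controlled only for first integration variable up to `s₁`, so the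
  -- frozen integral is moved to that smaller interval before comparing.
  rw [← deltaIntegral_interval hT₁ ha₁ houter hs₁]
  refine deltaIntegral_mono (hcI s₁) (hlI s₁ hs₁A) hinner (houter.mono hsubI)
    (hmI s₁ hs₁A) (hmI s₁ hs₁A) le_rfl (fun x hx _ => ?_) fun x hx _ => ?_
  · have hsec : ContinuousOn (fun y => f t₁ t₂ x y * u x y) (interval T₂ a₂ t₂) :=
      continuousOn_section (k := fun x y => f t₁ t₂ x y * u x y) (hfuc t₁ ht₁ t₂ ht₂) (hsubI hx)
    have hsec' : ContinuousOn (fun y => f s₁ s₂ x y * u x y) (interval T₂ a₂ s₂) :=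
      continuousOn_section (k := fun x y => f s₁ s₂ x y * u x y) (hfuc s₁ hs₁A s₂ hs₂B) hx
    calc deltaIntegral (interval T₂ a₂ s₂) (fun y => f s₁ s₂ x y * u x y) a₂ s₂
        ≤ deltaIntegral (interval T₂ a₂ s₂) (fun y => f t₁ t₂ x y * u x y) a₂ s₂ := by
          refine deltaIntegral_mono (hcJ s₂) (hlJ s₂ hs₂B) hsec' (hsec.mono hsubJ)
            (hmJ s₂ hs₂B) (hmJ s₂ hs₂B) le_rfl (fun y hy _ => ?_)
            fun y hy _ => hfu0 t₁ ht₁ t₂ ht₂ x (hsubI hx) y (hsubJ hy)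
          refine mul_le_mul_of_nonneg_right ?_ (hu0 _ (hIA _ hx) _ (hIB _ hy))
          have hm := hfmono x (hIA _ hx) y (hIB _ hy)
          have hxs : x ≤ s₁ := hx.2.2
          have hys : y ≤ s₂ := hy.2.2
          exact (hm.1 s₂ ⟨hs₂B, hys⟩ ⟨hs₁A, hxs⟩ ⟨ht₁, hxs.trans hst₁⟩ hst₁).trans
            (hm.2 t₁ ⟨ht₁, hxs.trans hst₁⟩ ⟨hs₂B, hys⟩ ⟨ht₂, hys.trans hst₂⟩ hst₂)
      _ = deltaIntegral (interval T₂ a₂ t₂) (fun y => f t₁ t₂ x y * u x y) a₂ s₂ :=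
          deltaIntegral_interval hT₂ ha₂ hsec hs₂
      _ ≤ deltaIntegral (interval T₂ a₂ t₂) (fun y => f t₁ t₂ x y * u x y) a₂ t₂ :=
          deltaIntegral_mono (hcJ t₂) (hlJ t₂ ht₂) hsec hsec hs₂ (hmJ t₂ ht₂) hst₂
            (fun _ _ _ => le_rfl) fun y hy _ => hfu0 t₁ ht₁ t₂ ht₂ x (hsubI hx) y hy
  · exact deltaIntegral_nonneg (hcJ t₂) (hlJ t₂ ht₂)
      (continuousOn_section (k := fun x y => f t₁ t₂ x y * u x y) (hfuc t₁ ht₁ t₂ ht₂)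
        (hsubI hx)) (hmJ t₂ ht₂) fun y hy _ => hfu0 t₁ ht₁ t₂ ht₂ x (hsubI hx) y hy

/-! ### The inequality with powers -/

/-- With `v = u^p / a`, the left side equals `a^(q/p - 1) * v^(q/p)`. Since `q/p ≤ 1`, the power of
`v` is at most `max v 1`; this linearizes the inequality. -/
theorem rpow_mul_rpow_le {u a p q : ℝ} (hu : 0 ≤ u) (ha : 0 < a) (hp : 0 < p) (hq : 0 < q)
    (hqp : q ≤ p) : u ^ q / a ≤ a ^ (q / p - 1) * max (u ^ p / a) 1 := by
  set v := u ^ p / a with hv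
  have hv0 : 0 ≤ v := by positivity
  have huq : u ^ q = a ^ (q / p) * v ^ (q / p) := by
    rw [← Real.mul_rpow ha.le hv0, hv, mul_div_cancel₀ _ ha.ne', ← Real.rpow_mul hu,
      mul_div_cancel₀ _ hp.ne']
  have hvq : v ^ (q / p) ≤ max v 1 := by
    have hqp1 : q / p ≤ 1 := (div_le_one hp).2 hqp
    calc v ^ (q / p) ≤ (max v 1) ^ (q / p) :=
          Real.rpow_le_rpow hv0 (le_max_left _ _) (by positivity)
      _ ≤ (max v 1) ^ (1 : ℝ) := Real.rpow_le_rpow_of_exponent_le (le_max_right _ _) hqp1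
      _ = max v 1 := Real.rpow_one _
  rw [huq, Real.rpow_sub_one ha.ne', mul_div_right_comm]
  gcongr

/-- Dividing by `a (s₁, s₂)`, which dominates `a` at all earlier points, turns the hypothesis into a
linear inequality for `v` with constant `1` and coefficient `g`. Truncating `v` below at `1` is
harmless because the right-hand side is at least `1`. -/
theorem le_rpow_mul_deltaExp_rpow (hA : IsClosed A) (hB : IsClosed B) (ha₁ : IsLeast A a₁)
    (ha₂ : IsLeast B a₂) {u a f : ℝ → ℝ → ℝ} {p q : ℝ} (hp : 0 < p) (hq : 0 < q) (hqp : q ≤ p)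
    (hu : ContinuousOn (fun x : ℝ × ℝ => u x.1 x.2) (A ×ˢ B))
    (ha : ContinuousOn (fun x : ℝ × ℝ => a x.1 x.2) (A ×ˢ B))
    (hf : ContinuousOn (fun x : ℝ × ℝ => f x.1 x.2) (A ×ˢ B))
    (hu0 : ∀ t₁ ∈ A, ∀ t₂ ∈ B, 0 ≤ u t₁ t₂) (ha0 : ∀ t₁ ∈ A, ∀ t₂ ∈ B, 0 < a t₁ t₂)
    (hf0 : ∀ t₁ ∈ A, ∀ t₂ ∈ B, 0 ≤ f t₁ t₂) (hmono : NondecreasingInEach A B a)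
    (h : ∀ t₁ ∈ A, ∀ t₂ ∈ B, u t₁ t₂ ^ p ≤ a t₁ t₂ + deltaIntegral A (fun s₁ =>
      deltaIntegral B (fun s₂ => f s₁ s₂ * u s₁ s₂ ^ q) a₂ t₂) a₁ t₁)
    {t₁ t₂ : ℝ} (ht₁ : t₁ ∈ A) (ht₂ : t₂ ∈ B) :
    u t₁ t₂ ≤ a t₁ t₂ ^ (1 / p) * (deltaExp A (fun τ => deltaIntegral B
      (fun s₂ => f τ s₂ * a τ s₂ ^ (q / p - 1)) a₂ t₂) t₁ a₁) ^ (1 / p) := by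
  set v : ℝ → ℝ → ℝ := fun x y => max (u x y ^ p / a x y) 1 with hv
  set g : ℝ → ℝ → ℝ := fun x y => f x y * a x y ^ (q / p - 1) with hg
  have hup : ContinuousOn (fun x : ℝ × ℝ => u x.1 x.2 ^ p) (A ×ˢ B) :=
    hu.rpow_const fun _ _ => Or.inr hp.le
  have huq : ContinuousOn (fun x : ℝ × ℝ => u x.1 x.2 ^ q) (A ×ˢ B) :=
    hu.rpow_const fun _ _ => Or.inr hq.le
  have hvc : ContinuousOn (fun x : ℝ × ℝ => v x.1 x.2) (A ×ˢ B) :=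
    (hup.div ha fun x hx => (ha0 _ hx.1 _ hx.2).ne').sup continuousOn_const
  have hgc : ContinuousOn (fun x : ℝ × ℝ => g x.1 x.2) (A ×ˢ B) :=
    hf.mul (ha.rpow_const fun x hx => Or.inl (ha0 _ hx.1 _ hx.2).ne')
  have hg0 : ∀ x ∈ A, ∀ y ∈ B, 0 ≤ g x y := fun x hx y hy =>
    mul_nonneg (hf0 x hx y hy) (Real.rpow_nonneg (ha0 x hx y hy).le _)
  have hgvc : ContinuousOn (fun x : ℝ × ℝ => g x.1 x.2 * v x.1 x.2) (A ×ˢ B) := hgc.mul hvc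
  have hfuc : ContinuousOn (fun x : ℝ × ℝ => f x.1 x.2 * u x.1 x.2 ^ q) (A ×ˢ B) := hf.mul huq
  have hv1 : ∀ x y, 1 ≤ v x y := fun x y => le_max_right _ _
  have hgv0 : ∀ x ∈ A, ∀ y ∈ B, 0 ≤ g x y * v x y := fun x hx y hy =>
    mul_nonneg (hg0 x hx y hy) (zero_le_one.trans (hv1 x y))
  have hIgv := fun t ht => continuousOn_deltaIntegral (k := fun x y => g x y * v x y)
    hA hB ha₁ ha₂ hgvc (t := t) ht
  have hIfu := fun t ht => continuousOn_deltaIntegral (k := fun x y => f x y * u x y ^ q)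
    hA hB ha₁ ha₂ hfuc (t := t) ht
  have hsgv := fun x hx => continuousOn_section (k := fun x y => g x y * v x y) hgvc (s := x) hx
  have hsfu := fun x hx => continuousOn_section (k := fun x y => f x y * u x y ^ q) hfuc
    (s := x) hx
  have hIgv0 : ∀ t ∈ B, ∀ x ∈ A, 0 ≤ deltaIntegral B (fun y => g x y * v x y) a₂ t :=
    fun t ht x hx => deltaIntegral_nonneg hB ha₂ (hsgv x hx) ht fun y hy _ => hgv0 x hx y hy
  have hvle : ∀ s₁ ∈ A, ∀ s₂ ∈ B, v s₁ s₂ ≤ 1 + deltaIntegral A (fun x =>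
      deltaIntegral B (fun y => g x y * v x y) a₂ s₂) a₁ s₁ := by
    intro s₁ hs₁ s₂ hs₂
    have hapos := ha0 s₁ hs₁ s₂ hs₂
    refine max_le ?_ (le_add_of_nonneg_right (deltaIntegral_nonneg hA ha₁ (hIgv s₂ hs₂) hs₁
      fun x hx _ => hIgv0 s₂ hs₂ x hx))
    rw [div_le_iff₀ hapos, add_mul, one_mul]
    refine (h s₁ hs₁ s₂ hs₂).trans (add_le_add le_rfl ?_)
    rw [← deltaIntegral_mul_const hA ha₁ (hIgv s₂ hs₂) hs₁]
    refine deltaIntegral_mono hA ha₁ (hIfu s₂ hs₂) ((hIgv s₂ hs₂).fun_mul continuousOn_const)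
      hs₁ hs₁ le_rfl (fun x hx hxs => ?_)
      fun x hx _ => mul_nonneg (hIgv0 s₂ hs₂ x hx) hapos.le
    rw [← deltaIntegral_mul_const hB ha₂ (hsgv x hx) hs₂]
    refine deltaIntegral_mono hB ha₂ (hsfu x hx) ((hsgv x hx).fun_mul continuousOn_const)
      hs₂ hs₂ le_rfl (fun y hy hys => ?_)
      fun y hy _ => mul_nonneg (hgv0 x hx y hy) hapos.le
    have hxy := ha0 x hx y hy
    have hale : a x y ≤ a s₁ s₂ :=
      (hmono.1 y hy hx hs₁ hxs).trans (hmono.2 s₁ hs₁ hy hs₂ hys)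
    have hkey := rpow_mul_rpow_le (hu0 x hx y hy) hxy hp hq hqp
    rw [div_le_iff₀ hxy] at hkey
    calc f x y * u x y ^ q
        ≤ f x y * (a x y ^ (q / p - 1) * v x y * a x y) :=
          mul_le_mul_of_nonneg_left hkey (hf0 x hx y hy)
      _ = g x y * v x y * a x y := by simp only [hg]; ring
      _ ≤ g x y * v x y * a s₁ s₂ := mul_le_mul_of_nonneg_left hale (hgv0 x hx y hy)
  have hmain := le_mul_deltaExp_of_le_add (a := fun _ _ => 1) hA hB ha₁ ha₂ hvc hgc
    (fun x _ y _ => zero_le_one.trans (hv1 x y)) hg0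
    ⟨fun _ _ => monotoneOn_const, fun _ _ => monotoneOn_const⟩ hvle ht₁ ht₂
  rw [one_mul] at hmain
  set e := deltaExp A (fun τ => deltaIntegral B (fun s₂ => g τ s₂) a₂ t₂) t₁ a₁
  have hapos := ha0 t₁ ht₁ t₂ ht₂
  -- Nonnegativity of this exponential is read off from `1 ≤ v ≤ e`; it is needed to split the real
  -- power of a product.
  have he0 : 0 ≤ e := zero_le_one.trans ((hv1 t₁ t₂).trans hmain)
  have hpow : u t₁ t₂ ^ p ≤ a t₁ t₂ * e := by
    rw [mul_comm, ← div_le_iff₀ hapos]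
    exact (le_max_left _ _).trans hmain
  rw [← Real.mul_rpow hapos.le he0]
  calc u t₁ t₂ = (u t₁ t₂ ^ p) ^ (1 / p) := by
        rw [← Real.rpow_mul (hu0 t₁ ht₁ t₂ ht₂), mul_one_div_cancel hp.ne', Real.rpow_one]
    _ ≤ (a t₁ t₂ * e) ^ (1 / p) :=
        Real.rpow_le_rpow (Real.rpow_nonneg (hu0 t₁ ht₁ t₂ ht₂) _) hpow (by positivity)

end TimeScale

/-! ### The three inequalities on half-lines of two time scales -/

theorem mainTheorem11 (T₁ T₂ : Set ℝ) (hT₁ : TimeScale.IsTimeScale T₁)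
    (hT₂ : TimeScale.IsTimeScale T₂) (a₁ a₂ : ℝ) (ha₁ : a₁ ∈ T₁) (ha₂ : a₂ ∈ T₂)
    (A B : Set ℝ) (hA : A = TimeScale.halfLine T₁ a₁) (hB : B = TimeScale.halfLine T₂ a₂) :
    -- the linear inequality
    (∀ u a f : ℝ → ℝ → ℝ,
      ContinuousOn (fun x : ℝ × ℝ => u x.1 x.2) (A ×ˢ B) →
      ContinuousOn (fun x : ℝ × ℝ => a x.1 x.2) (A ×ˢ B) →
      ContinuousOn (fun x : ℝ × ℝ => f x.1 x.2) (A ×ˢ B) →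
      (∀ t₁ ∈ A, ∀ t₂ ∈ B, 0 ≤ u t₁ t₂ ∧ 0 ≤ a t₁ t₂ ∧ 0 ≤ f t₁ t₂) →
      TimeScale.NondecreasingInEach A B a →
      (∀ t₁ ∈ A, ∀ t₂ ∈ B,
        u t₁ t₂ ≤ a t₁ t₂ + TimeScale.deltaIntegral A (fun s₁ =>
          TimeScale.deltaIntegral B (fun s₂ => f s₁ s₂ * u s₁ s₂) a₂ t₂) a₁ t₁) →
      ∀ t₁ ∈ A, ∀ t₂ ∈ B,
        u t₁ t₂ ≤ a t₁ t₂ * TimeScale.deltaExp A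
          (fun τ => TimeScale.deltaIntegral B (fun s₂ => f τ s₂) a₂ t₂) t₁ a₁) ∧
    -- the linear inequality with a kernel
    (∀ (u a : ℝ → ℝ → ℝ) (f : ℝ → ℝ → ℝ → ℝ → ℝ),
      ContinuousOn (fun x : ℝ × ℝ => u x.1 x.2) (A ×ˢ B) →
      ContinuousOn (fun x : ℝ × ℝ => a x.1 x.2) (A ×ˢ B) →
      ContinuousOn (fun x : ℝ × ℝ × ℝ × ℝ => f x.1 x.2.1 x.2.2.1 x.2.2.2)
        (TimeScale.kernelDomain A B) →
      (∀ t₁ ∈ A, ∀ t₂ ∈ B, 0 ≤ u t₁ t₂ ∧ 0 ≤ a t₁ t₂) →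
      (∀ x ∈ TimeScale.kernelDomain A B, 0 ≤ f x.1 x.2.1 x.2.2.1 x.2.2.2) →
      TimeScale.NondecreasingInEach A B a →
      (∀ s₁ ∈ A, ∀ s₂ ∈ B, TimeScale.NondecreasingInEach (A ∩ Set.Ici s₁) (B ∩ Set.Ici s₂)
        (fun t₁ t₂ => f t₁ t₂ s₁ s₂)) →
      (∀ t₁ ∈ A, ∀ t₂ ∈ B,
        u t₁ t₂ ≤ a t₁ t₂ +
          TimeScale.deltaIntegral (TimeScale.interval T₁ a₁ t₁) (fun s₁ =>
            TimeScale.deltaIntegral (TimeScale.interval T₂ a₂ t₂)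
              (fun s₂ => f t₁ t₂ s₁ s₂ * u s₁ s₂) a₂ t₂) a₁ t₁) →
      ∀ t₁ ∈ A, ∀ t₂ ∈ B,
        u t₁ t₂ ≤ a t₁ t₂ * TimeScale.deltaExp (TimeScale.interval T₁ a₁ t₁)
          (fun τ => TimeScale.deltaIntegral (TimeScale.interval T₂ a₂ t₂)
            (fun s₂ => f t₁ t₂ τ s₂) a₂ t₂) t₁ a₁) ∧
    -- the inequality with powers
    (∀ (u a f : ℝ → ℝ → ℝ) (p q : ℝ), 0 < p → 0 < q → q ≤ p →
      ContinuousOn (fun x : ℝ × ℝ => u x.1 x.2) (A ×ˢ B) →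
      ContinuousOn (fun x : ℝ × ℝ => a x.1 x.2) (A ×ˢ B) →
      ContinuousOn (fun x : ℝ × ℝ => f x.1 x.2) (A ×ˢ B) →
      (∀ t₁ ∈ A, ∀ t₂ ∈ B, 0 ≤ u t₁ t₂ ∧ 0 < a t₁ t₂ ∧ 0 ≤ f t₁ t₂) →
      TimeScale.NondecreasingInEach A B a →
      (∀ t₁ ∈ A, ∀ t₂ ∈ B,
        u t₁ t₂ ^ p ≤ a t₁ t₂ + TimeScale.deltaIntegral A (fun s₁ =>
          TimeScale.deltaIntegral B (fun s₂ => f s₁ s₂ * u s₁ s₂ ^ q) a₂ t₂) a₁ t₁) →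
      ∀ t₁ ∈ A, ∀ t₂ ∈ B,
        u t₁ t₂ ≤ a t₁ t₂ ^ (1 / p) * (TimeScale.deltaExp A
          (fun τ => TimeScale.deltaIntegral B
            (fun s₂ => f τ s₂ * a τ s₂ ^ (q / p - 1)) a₂ t₂) t₁ a₁) ^ (1 / p)) := by
  have hAc : IsClosed A := hA ▸ TimeScale.isClosed_halfLine hT₁.2 a₁
  have hBc : IsClosed B := hB ▸ TimeScale.isClosed_halfLine hT₂.2 a₂
  have hAl : IsLeast A a₁ := hA ▸ TimeScale.isLeast_halfLine ha₁
  have hBl : IsLeast B a₂ := hB ▸ TimeScale.isLeast_halfLine ha₂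
  refine ⟨?_, ?_, ?_⟩
  · intro u a f hu _ hf h0 hmono h t₁ ht₁ t₂ ht₂
    exact TimeScale.le_mul_deltaExp_of_le_add hAc hBc hAl hBl hu hf
      (fun x hx y hy => (h0 x hx y hy).1) (fun x hx y hy => (h0 x hx y hy).2.2) hmono h ht₁ ht₂
  · intro u a f hu _ hf h0 hf0 hmono hfmono h t₁ ht₁ t₂ ht₂
    exact TimeScale.le_mul_deltaExp_of_le_add_kernel hT₁.2 hT₂.2 ha₁ ha₂ hA hB hu hf
      (fun x hx y hy => (h0 x hx y hy).1) hf0 hmono hfmono h ht₁ ht₂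
  · intro u a f p q hp hq hqp hu ha hf h0 hmono h t₁ ht₁ t₂ ht₂
    exact TimeScale.le_rpow_mul_deltaExp_rpow hAc hBc hAl hBl hp hq hqp hu ha hf
      (fun x hx y hy => (h0 x hx y hy).1) (fun x hx y hy => (h0 x hx y hy).2.1)
      (fun x hx y hy => (h0 x hx y hy).2.2) hmono h ht₁ ht₂
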